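/- Consider a Markov decision process with a finite nonempty state space $S$, a finite action set $A$, and transition probabilities $p(s'\mid s,a)$. A policy $\pi$ assigns to each state $s$ a probability distribution $\pi(s,\cdot)$ on $A$; it induces the Markov chain on $S$ with transition matrix $P_\pi(s,s')=\sum_a \pi(s,a)\,p(s'\mid s,a)$. For a measure $\nu$ on $S$ and policies $\tilde\pi,\pi$ let $$K_\nu(\tilde\pi,\pi)=\sum_{s}\nu(s)\sum_a \tilde\pi(s,a)\ln\frac{\tilde\pi(s,a)}{\pi(s,a)}\in[0,\infty]$$ (with the conventions $0\ln\frac{0}{q}=0$ for $q\ge 0$, $p\ln\frac p0=\infty$ for $p>0$, and $0\cdot\infty=0$), and let $\|\mu-\mu'\|_{\mathrm{TV}}=\sup_{U\subseteq S}|\mu(U)-\mu'(U)|$. Let $\tilde\pi$ be a policy such that $P_{\tilde\pi}$ is irreducible and aperiodic. Then $P_{\tilde\pi}$ has a unique stationary distribution $\mu_{\tilde\pi}$. Moreover, for every $c>0$ and every measure $\nu$ on $S$ with $\nu(s)>0$ for all $s\in S$, there exist constants $C,m_1,m_2>0$ such that for every policy $\pi$ in $$\mathcal P_c=\{\pi :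 K_\nu(\tilde\pi,\pi)\le c\}$$ the chain $P_\pi$ has a unique stationary distribution $\mu_\pi$ and the following hold: 1. for every integer $t\ge 0$, $\ \sup_{s\in S}\|P_\pi^t(s,\cdot)-\mu_\pi\|_{\mathrm{TV}}\le m_1e^{-m_2t}$; 2. for every state $s$ and every action $a$ with $\tilde\pi(s,a)>0$, $\ \frac1C\le\frac{\tilde\pi(s,a)}{\pi(s,a)}\le C$; 3. for every state $s$, $\ \frac1C\le\frac{\mu_{\tilde\pi}(s)}{\mu_\pi(s)}\le C$. (The constants $C,m_1,m_2$ do not depend on $\pi$, $s$, $a$ or $t$; in particular the denominators in 2 and 3 are positive.) -/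

import Mathlib

open scoped ENNReal BigOperators

namespace FiniteMDP

/-- The dynamics of a Markov decision process with finite state space `S` and finite action
set `A`: `prob s a s'` is the probability of moving to state `s'` after action `a` in state `s`. -/
structure Dynamics (S A : Type*) [Fintype S] where
  prob : S → A → S → ℝ
  prob_mem : ∀ s a, prob s a ∈ stdSimplex ℝ S

/-- A (stationary, randomized) policy: `prob s a` is the probability of action `a` in state `s`. -/
structure Policy (S A : Type*) [Fintype A] where
  prob : S → A → ℝ
  prob_mem : ∀ s, prob s ∈ stdSimplex ℝ A

/-- The transition matrix `P_π` of the Markov chain on states induced by the policy `π`: from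
state `s`, draw an action `a` from `π(s, ·)`, then draw the next state from the dynamics. -/
def inducedChain {S A : Type*} [Fintype S] [Fintype A] (M : Dynamics S A) (π : Policy S A) :
    Matrix S S ℝ :=
  Matrix.of fun s s' => ∑ a, π.prob s a * M.prob s a s'

/-- Every state has period one: the greatest common divisor of the possible return times
`{t ≥ 1 : P^t(s, s) > 0}` is one. -/
def IsAperiodic {S : Type*} [Fintype S] [DecidableEq S] (P : Matrix S S ℝ) : Prop :=
  ∀ s, ∀ d : ℕ, (∀ t : ℕ, 1 ≤ t → 0 < (P ^ t) s s → d ∣ t) → d = 1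

/-- `μ` is a probability vector on the states with `μ P = μ`. -/
def IsStationary {S : Type*} [Fintype S] (P : Matrix S S ℝ) (μ : S → ℝ) : Prop :=
  μ ∈ stdSimplex ℝ S ∧ Matrix.vecMul μ P = μ

/-- The total variation distance `sup_U |μ(U) - ν(U)|` over all sets `U` of states. -/
noncomputable def tvDist {S : Type*} [Fintype S] (μ ν : S → ℝ) : ℝ :=
  ⨆ U : Finset S, |∑ s ∈ U, μ s - ∑ s ∈ U, ν s|

open Classical in
/-- The Kullback-Leibler divergence `∑ a, p a * log (p a / q a)` of two probability vectors, with
`0 * log (0 / q a) = 0`, and with value `∞` if `q a = 0 < p a` for some `a`. For probability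
vectors the real sum is nonnegative, so that `ENNReal.ofReal` does not change it. -/
noncomputable def klVec {A : Type*} [Fintype A] (p q : A → ℝ) : ℝ≥0∞ :=
  if ∀ a, q a = 0 → p a = 0 then ENNReal.ofReal (∑ a, p a * Real.log (p a / q a)) else ∞

/-- `K_ν(π', π) = ∑ s, ν(s) ∑ a, π'(s, a) log (π'(s, a) / π(s, a))`, with values in `[0, ∞]`. -/
noncomputable def klPolicy {S A : Type*} [Fintype S] [Fintype A] [MeasurableSpace S]
    (ν : MeasureTheory.Measure S) (π' π : Policy S A) : ℝ≥0∞ :=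
  ∑ s, ν {s} * klVec (π'.prob s) (π.prob s)

/-- The Kullback-Leibler ball `{π : K_ν(π', π) ≤ c}` in the space of all policies. -/
def klBall {S A : Type*} [Fintype S] [Fintype A] [MeasurableSpace S]
    (ν : MeasureTheory.Measure S) (π' : Policy S A) (c : ℝ) : Set (Policy S A) :=
  {π | klPolicy ν π' π ≤ ENNReal.ofReal c}

end FiniteMDP

namespace FiniteMDP

/-! A bound on the divergence prevents `π` from nearly dropping an action that `π'` uses: some `δ >
0` satisfies `δ π' ≤ π` on the whole ball (`exists_forall_mem_klBall_mul_le`), hence `δ P_π' ≤ P_π`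
entrywise. Irreducibility and aperiodicity make some power `P_π' ^ N` at least `ε > 0` in every
entry, so `P_π ^ N ≥ η = δ ^ N ε` uniformly over the ball. This Doeblin condition yields everything
else: uniqueness, geometric mixing at a rate depending only on `η` and `N`, and `η ≤ μ_π ≤ 1`. -/

lemma exists_pos_forall_le_of_pos {ι : Type*} [Finite ι] (f : ι → ℝ) :
    ∃ δ : ℝ, 0 < δ ∧ ∀ i, 0 < f i → δ ≤ f i := by
  classical
  cases nonempty_fintype ι
  by_cases h : (Finset.univ.filter fun i => 0 < f i).Nonempty
  · obtain ⟨i, hi, hmin⟩ := Finset.exists_min_image _ f h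
    exact ⟨f i, (Finset.mem_filter.1 hi).2, fun j hj => hmin j (by simpa using hj)⟩
  · refine ⟨1, one_pos, fun i hi => absurd ⟨i, ?_⟩ h⟩
    simpa using hi

section Primitivity

variable {S : Type*} [Fintype S] [DecidableEq S] {P : Matrix S S ℝ}

lemma pow_apply_nonneg (hP : ∀ i j, 0 ≤ P i j) (n : ℕ) (i j : S) : 0 ≤ (P ^ n) i j := by
  induction n generalizing j with
  | zero => rw [pow_zero, Matrix.one_apply]; split_ifs <;> norm_num
  | succ n ih =>
    rw [pow_succ, Matrix.mul_apply]
    exact Finset.sum_nonneg fun k _ => mul_nonneg (ih k) (hP k j)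

lemma pow_add_apply_pos (hP : ∀ i j, 0 ≤ P i j) {m n : ℕ} {i j k : S}
    (h₁ : 0 < (P ^ m) i j) (h₂ : 0 < (P ^ n) j k) : 0 < (P ^ (m + n)) i k := by
  rw [pow_add, Matrix.mul_apply]
  exact (mul_pos h₁ h₂).trans_le (Finset.single_le_sum (f := fun l => (P ^ m) i l * (P ^ n) l k)
    (fun l _ => mul_nonneg (pow_apply_nonneg hP _ _ _) (pow_apply_nonneg hP _ _ _))
    (Finset.mem_univ j))

/-- Return times are closed under addition, and an additive semigroup of naturals with gcd one
contains every large integer. -/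
lemma IsAperiodic.exists_pow_apply_self_pos (h : IsAperiodic P) (hP : ∀ i j, 0 ≤ P i j) (s : S) :
    ∃ n, ∀ m ≥ n, 0 < (P ^ m) s s := by
  set R : Set ℕ := {t | 1 ≤ t ∧ 0 < (P ^ t) s s}
  have hgcd : Nat.setGcd R = 1 := h s _ fun t ht hpos => Nat.setGcd_dvd_of_mem ⟨ht, hpos⟩
  obtain ⟨n, hn⟩ := Nat.exists_mem_closure_of_ge R
  refine ⟨n, fun m hm => ?_⟩
  refine AddSubmonoid.closure_induction (motive := fun m _ => 0 < (P ^ m) s s) (fun x hx => hx.2)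
    (by simp) (fun x y _ _ hx hy => pow_add_apply_pos hP hx hy) (hn m hm (hgcd ▸ one_dvd m))

/-- An irreducible aperiodic nonnegative matrix is primitive. -/
lemma IsAperiodic.isPrimitive (h : IsAperiodic P) (hirr : P.IsIrreducible) : P.IsPrimitive := by
  refine ⟨hirr.nonneg, ?_⟩
  choose n hn using h.exists_pow_apply_self_pos hirr.nonneg
  choose k _ hk using (Matrix.isIrreducible_iff_exists_pow_pos hirr.nonneg).1 hirr
  refine ⟨∑ i, n i + ∑ i, ∑ j, k i j + 1, Nat.succ_pos _, fun i j => ?_⟩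
  have h₁ : n i ≤ ∑ i, n i := Finset.single_le_sum (fun _ _ => Nat.zero_le _) (Finset.mem_univ i)
  have h₂ : k i j ≤ ∑ i, ∑ j, k i j :=
    (Finset.single_le_sum (f := k i) (fun _ _ => Nat.zero_le _) (Finset.mem_univ j)).trans
      (Finset.single_le_sum (f := fun i => ∑ j, k i j) (fun _ _ => Nat.zero_le _)
        (Finset.mem_univ i))
  have := pow_add_apply_pos hirr.nonneg
    (hn i (∑ i, n i + ∑ i, ∑ j, k i j + 1 - k i j) (by omega)) (hk i j)
  rwa [Nat.sub_add_cancel (by omega)] at this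

end Primitivity

lemma IsStationary.apply_le_one {S : Type*} [Fintype S] {P : Matrix S S ℝ} {μ : S → ℝ}
    (h : IsStationary P μ) (s : S) : μ s ≤ 1 := by
  rw [← h.1.2]
  exact Finset.single_le_sum (fun i _ => h.1.1 i) (Finset.mem_univ s)

lemma tvDist_le_sum_abs {S : Type*} [Fintype S] (μ ρ : S → ℝ) : tvDist μ ρ ≤ ∑ i, |μ i - ρ i| := by
  refine ciSup_le fun U => ?_
  rw [← Finset.sum_sub_distrib]
  exact (Finset.abs_sum_le_sum_abs _ _).trans
    (Finset.sum_le_sum_of_subset_of_nonneg (Finset.subset_univ U) fun _ _ _ => abs_nonneg _)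

section Doeblin

open Matrix

variable {S : Type*} [Fintype S] [DecidableEq S] {P : Matrix S S ℝ}

lemma sum_vecMul_of_mem_rowStochastic (hP : P ∈ rowStochastic ℝ S) (v : S → ℝ) :
    ∑ j, (v ᵥ* P) j = ∑ i, v i := by
  simp only [vecMul, dotProduct]
  rw [Finset.sum_comm]
  simp [← Finset.mul_sum, sum_row_of_mem_rowStochastic hP]

lemma sum_abs_vecMul_le (hP : P ∈ rowStochastic ℝ S) (v : S → ℝ) :
    ∑ j, |(v ᵥ* P) j| ≤ ∑ i, |v i| := by
  rw [← sum_vecMul_of_mem_rowStochastic hP fun i => |v i|]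
  refine Finset.sum_le_sum fun j _ => ?_
  refine (Finset.abs_sum_le_sum_abs _ _).trans_eq (Finset.sum_congr rfl fun i _ => ?_)
  rw [abs_mul, abs_of_nonneg (nonneg_of_mem_rowStochastic hP)]

/-- Doeblin's contraction: a stochastic matrix whose entries are all at least `η` contracts the
`ℓ¹` norm of vectors of total mass zero. -/
lemma sum_abs_vecMul_le_of_le (hP : P ∈ rowStochastic ℝ S) {η : ℝ} (hη : ∀ i j, η ≤ P i j)
    {v : S → ℝ} (hv : ∑ i, v i = 0) :
    ∑ j, |(v ᵥ* P) j| ≤ (1 - Fintype.card S * η) * ∑ i, |v i| := by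
  -- As `v` has mass zero, subtracting the constant `η` from `P` leaves `v P` unchanged.
  have key : ∀ j, |(v ᵥ* P) j| ≤ ∑ i, |v i| * (P i j - η) := fun j => by
    have : (v ᵥ* P) j = ∑ i, v i * (P i j - η) := by
      simp [vecMul, dotProduct, mul_sub, ← Finset.sum_mul, hv]
    rw [this]
    refine (Finset.abs_sum_le_sum_abs _ _).trans_eq (Finset.sum_congr rfl fun i _ => ?_)
    rw [abs_mul, abs_of_nonneg (sub_nonneg.2 (hη i j))]
  refine (Finset.sum_le_sum fun j _ => key j).trans_eq ?_
  rw [Finset.sum_comm, Finset.mul_sum]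
  refine Finset.sum_congr rfl fun i _ => ?_
  rw [← Finset.mul_sum, Finset.sum_sub_distrib, sum_row_of_mem_rowStochastic hP]
  simp [mul_comm]

/-- Each full block of `N` steps contracts by `r`; the `t % N` remaining steps do not expand. -/
lemma sum_abs_vecMul_pow_le (hP : P ∈ rowStochastic ℝ S) {η r : ℝ} {N : ℕ}
    (hη : ∀ i j, η ≤ (P ^ N) i j) (hr₀ : 0 ≤ r) (hr : 1 - Fintype.card S * η ≤ r)
    {v : S → ℝ} (hv : ∑ i, v i = 0) (t : ℕ) :
    ∑ j, |(v ᵥ* P ^ t) j| ≤ r ^ (t / N) * ∑ i, |v i| := by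
  have hblock : ∀ k : ℕ, ∑ j, |(v ᵥ* (P ^ N) ^ k) j| ≤ r ^ k * ∑ i, |v i| := by
    intro k
    induction k with
    | zero => simp
    | succ k ih =>
      have hsum : ∑ j, (v ᵥ* (P ^ N) ^ k) j = 0 := by
        rw [sum_vecMul_of_mem_rowStochastic (pow_mem (pow_mem hP _) _), hv]
      rw [pow_succ (P ^ N), ← vecMul_vecMul, pow_succ' r, mul_assoc]
      refine (sum_abs_vecMul_le_of_le (pow_mem hP N) hη hsum).trans ?_
      exact mul_le_mul hr ih (Finset.sum_nonneg fun _ _ => abs_nonneg _) hr₀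
  rw [← Nat.div_add_mod t N, pow_add, pow_mul, ← vecMul_vecMul, Nat.div_add_mod t N]
  exact (sum_abs_vecMul_le (pow_mem hP _) _).trans (hblock _)

/-- Every stochastic matrix on a nonempty finite set has a stationary distribution. -/
lemma exists_isStationary [Nonempty S] (hP : P ∈ rowStochastic ℝ S) : ∃ μ, IsStationary P μ := by
  have hdet : (P - 1).det = 0 := by
    refine exists_mulVec_eq_zero_iff.1 ⟨1, one_ne_zero, ?_⟩
    rw [sub_mulVec, one_mulVec, hP.2, sub_self]
  obtain ⟨v, hv₀, hv⟩ := exists_vecMul_eq_zero_iff.2 hdet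
  rw [vecMul_sub, vecMul_one, sub_eq_zero] at hv
  have hle : ∀ j, |v j| ≤ ((fun i => |v i|) ᵥ* P) j := fun j => by
    conv_lhs => rw [← hv]
    refine (Finset.abs_sum_le_sum_abs _ _).trans_eq (Finset.sum_congr rfl fun i _ => ?_)
    rw [abs_mul, abs_of_nonneg (nonneg_of_mem_rowStochastic hP)]
  -- `|v| ≤ |v| P` entrywise and both sides have the same mass, so they agree.
  have heq : ((fun i => |v i|) ᵥ* P) = fun i => |v i| := by
    have := (Finset.sum_eq_sum_iff_of_le fun j _ => hle j).1
      (sum_vecMul_of_mem_rowStochastic hP fun i => |v i|).symm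
    exact funext fun j => (this j (Finset.mem_univ j)).symm
  have hpos : 0 < ∑ i, |v i| := by
    obtain ⟨i, hi⟩ := Function.ne_iff.1 hv₀
    exact Finset.sum_pos' (fun _ _ => abs_nonneg _) ⟨i, Finset.mem_univ i, abs_pos.2 hi⟩
  refine ⟨(∑ i, |v i|)⁻¹ • fun i => |v i|, ⟨fun i => ?_, ?_⟩, ?_⟩
  · exact mul_nonneg (inv_nonneg.2 hpos.le) (abs_nonneg _)
  · simp only [Pi.smul_apply, smul_eq_mul, ← Finset.mul_sum]
    exact inv_mul_cancel₀ hpos.ne'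
  · rw [smul_vecMul, heq]

lemma IsStationary.vecMul_pow {μ : S → ℝ} (h : IsStationary P μ) (n : ℕ) : μ ᵥ* P ^ n = μ := by
  induction n with
  | zero => simp
  | succ n ih => rw [pow_succ, ← vecMul_vecMul, ih, h.2]

lemma IsStationary.le_apply {μ : S → ℝ} (h : IsStationary P μ) {η : ℝ} {N : ℕ}
    (hη : ∀ i j, η ≤ (P ^ N) i j) (s : S) : η ≤ μ s := by
  rw [← h.vecMul_pow N]
  calc η = ∑ i, μ i * η := by rw [← Finset.sum_mul, h.1.2, one_mul]
    _ ≤ _ := Finset.sum_le_sum fun i _ => mul_le_mul_of_nonneg_left (hη i s) (h.1.1 i)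

/-- The difference is fixed by `P ^ N` yet strictly contracted by it. -/
lemma IsStationary.eq_of_pow_pos [Nonempty S] (hP : P ∈ rowStochastic ℝ S) {η : ℝ} (hη₀ : 0 < η)
    {N : ℕ} (hη : ∀ i j, η ≤ (P ^ N) i j) {μ ρ : S → ℝ} (hμ : IsStationary P μ)
    (hρ : IsStationary P ρ) : ρ = μ := by
  have hsum : ∑ i, (ρ - μ) i = 0 := by
    simp [Finset.sum_sub_distrib, hμ.1.2, hρ.1.2]
  have h := sum_abs_vecMul_le_of_le (pow_mem hP N) hη hsum
  rw [sub_vecMul, hμ.vecMul_pow, hρ.vecMul_pow] at h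
  have hcard : (0 : ℝ) < Fintype.card S := by exact_mod_cast Fintype.card_pos
  have hnn : 0 ≤ ∑ i, |(ρ - μ) i| := Finset.sum_nonneg fun _ _ => abs_nonneg _
  have hzero : ∑ i, |(ρ - μ) i| = 0 := by
    have := mul_pos hcard hη₀
    nlinarith
  rw [Finset.sum_eq_zero_iff_of_nonneg fun _ _ => abs_nonneg _] at hzero
  exact sub_eq_zero.1 (funext fun i => abs_eq_zero.1 (hzero i (Finset.mem_univ i)))

lemma tvDist_pow_le (hP : P ∈ rowStochastic ℝ S) {η r : ℝ} {N : ℕ}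
    (hη : ∀ i j, η ≤ (P ^ N) i j) (hr₀ : 0 ≤ r) (hr : 1 - Fintype.card S * η ≤ r)
    {μ : S → ℝ} (hμ : IsStationary P μ) (s : S) (t : ℕ) :
    tvDist ((P ^ t) s) μ ≤ 2 * r ^ (t / N) := by
  have hsum : ∑ i, ((Pi.single s 1 : S → ℝ) - μ) i = 0 := by
    simp [Finset.sum_sub_distrib, hμ.1.2]
  have h := sum_abs_vecMul_pow_le hP hη hr₀ hr hsum t
  have hrow : ((Pi.single s 1 : S → ℝ) - μ) ᵥ* P ^ t = (P ^ t) s - μ := by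
    rw [sub_vecMul, hμ.vecMul_pow, single_one_vecMul]
    rfl
  have hmass : ∑ i, |((Pi.single s 1 : S → ℝ) - μ) i| ≤ 2 := by
    calc ∑ i, |((Pi.single s 1 : S → ℝ) - μ) i|
        ≤ ∑ i, (|(Pi.single s 1 : S → ℝ) i| + |μ i|) :=
          Finset.sum_le_sum fun i _ => abs_sub _ _
      _ = ∑ i, ((Pi.single s 1 : S → ℝ) i + μ i) := by
          refine Finset.sum_congr rfl fun i _ => ?_
          rw [abs_of_nonneg (hμ.1.1 i), abs_of_nonneg]
          exact (Pi.single_nonneg.2 zero_le_one : (0 : S → ℝ) ≤ Pi.single s 1) i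
      _ = 2 := by
          rw [Finset.sum_add_distrib, hμ.1.2]
          norm_num
  rw [hrow] at h
  refine (tvDist_le_sum_abs _ _).trans (h.trans ?_)
  rw [mul_comm]
  exact mul_le_mul_of_nonneg_right hmass (pow_nonneg hr₀ _)

end Doeblin

/-- Rounding `t / N` down loses less than one block, at the cost of a factor `r⁻¹`. -/
lemma pow_div_le_exp {r : ℝ} (hr₀ : 0 < r) (hr₁ : r < 1) {N : ℕ} (hN : 0 < N) (t : ℕ) :
    r ^ (t / N) ≤ r⁻¹ * Real.exp (-(-Real.log r / N) * t) := by
  have hN' : (0 : ℝ) < N := by exact_mod_cast hN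
  have hdiv : (t : ℝ) / N - 1 ≤ (t / N : ℕ) := by
    rw [sub_le_iff_le_add, div_le_iff₀ hN']
    exact_mod_cast (Nat.lt_div_mul_add hN).le.trans_eq (by ring)
  have hlog := Real.log_neg hr₀ hr₁
  calc r ^ (t / N) = Real.exp (Real.log r * (t / N : ℕ)) := by
        rw [mul_comm, Real.exp_nat_mul, Real.exp_log hr₀]
    _ ≤ Real.exp (Real.log r * ((t : ℝ) / N - 1)) :=
        Real.exp_le_exp.2 (mul_le_mul_of_nonpos_left hdiv hlog.le)
    _ = Real.exp (-Real.log r + -(-Real.log r / N) * t) := by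
        congr 1
        ring
    _ = _ := by rw [Real.exp_add, Real.exp_neg, Real.exp_log hr₀]

section Divergence

lemma sub_le_mul_log_div {p q : ℝ} (hp : 0 ≤ p) (hq : 0 ≤ q) (h : q = 0 → p = 0) :
    p - q ≤ p * Real.log (p / q) := by
  rcases hp.eq_or_lt with rfl | hp
  · simpa using hq
  have hq : 0 < q := hq.lt_of_ne fun h' => hp.ne' (h h'.symm)
  have hlog := Real.one_sub_inv_le_log_of_pos (div_pos hp hq)
  calc p - q = p * (1 - (p / q)⁻¹) := by field_simp
    _ ≤ _ := mul_le_mul_of_nonneg_left hlog hp.le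

variable {A : Type*} [Fintype A]

/-- The terms other than `a` are at least `-q b`, so they total at least `-1` and the term at `a` is
at most `K + 1`. -/
lemma exp_neg_mul_le_of_klVec_le {p q : A → ℝ} (hp : p ∈ stdSimplex ℝ A)
    (hq : q ∈ stdSimplex ℝ A) {K : ℝ} (hK : 0 ≤ K) (h : klVec p q ≤ ENNReal.ofReal K)
    {a : A} (ha : 0 < p a) : Real.exp (-((K + 1) / p a)) * p a ≤ q a := by
  classical
  unfold klVec at h
  split_ifs at h with hac
  swap
  · simp at h
  have hsum : ∑ b, p b * Real.log (p b / q b) ≤ K := (ENNReal.ofReal_le_ofReal_iff hK).1 h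
  rw [← Finset.add_sum_erase _ _ (Finset.mem_univ a)] at hsum
  have hrest : -1 ≤ ∑ b ∈ Finset.univ.erase a, p b * Real.log (p b / q b) := by
    calc (-1 : ℝ) = -∑ b, q b := by rw [hq.2]
      _ ≤ -∑ b ∈ Finset.univ.erase a, q b := neg_le_neg
          (Finset.sum_le_sum_of_subset_of_nonneg (Finset.erase_subset _ _) fun b _ _ => hq.1 b)
      _ = ∑ b ∈ Finset.univ.erase a, -q b := by rw [Finset.sum_neg_distrib]
      _ ≤ _ := Finset.sum_le_sum fun b _ => by
          have := sub_le_mul_log_div (hp.1 b) (hq.1 b) (hac b)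
          have := hp.1 b
          linarith
  have hqa : 0 < q a := (hq.1 a).lt_of_ne fun h' => ha.ne' (hac a h'.symm)
  have hlog : Real.log (p a / q a) ≤ (K + 1) / p a := by
    rw [le_div_iff₀ ha]
    linarith
  rw [Real.log_le_iff_le_exp (div_pos ha hqa), div_le_iff₀ hqa] at hlog
  rw [Real.exp_neg, inv_mul_le_iff₀ (Real.exp_pos _)]
  exact hlog

variable {S : Type*} [Fintype S] [MeasurableSpace S]

lemma klVec_le_of_mem_klBall {ν : MeasureTheory.Measure S} {s : S} (hν : 0 < ν {s})
    {π' π : Policy S A} {c : ℝ} (h : π ∈ klBall ν π' c) :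
    klVec (π'.prob s) (π.prob s) ≤ ENNReal.ofReal (ENNReal.ofReal c / ν {s}).toReal := by
  -- `ν {s} = ∞` is allowed; the quotient is then `0`.
  rw [ENNReal.ofReal_toReal (ENNReal.div_ne_top ENNReal.ofReal_ne_top hν.ne')]
  rw [ENNReal.le_div_iff_mul_le (Or.inl hν.ne') (Or.inr ENNReal.ofReal_ne_top), mul_comm]
  exact (Finset.single_le_sum (f := fun s => ν {s} * klVec (π'.prob s) (π.prob s))
    (fun _ _ => zero_le) (Finset.mem_univ s)).trans h

/-- The policies of a Kullback-Leibler ball uniformly dominate a multiple of its center. -/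
lemma exists_forall_mem_klBall_mul_le (π' : Policy S A) (c : ℝ) {ν : MeasureTheory.Measure S}
    (hν : ∀ s, 0 < ν {s}) :
    ∃ δ : ℝ, 0 < δ ∧ δ ≤ 1 ∧ ∀ π ∈ klBall ν π' c, ∀ s a, δ * π'.prob s a ≤ π.prob s a := by
  obtain ⟨δ, hδ, h⟩ := exists_pos_forall_le_of_pos fun x : S × A =>
    Real.exp (-(((ENNReal.ofReal c / ν {x.1}).toReal + 1) / π'.prob x.1 x.2))
  refine ⟨min δ 1, lt_min hδ one_pos, min_le_right _ _, fun π hπ s a => ?_⟩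
  rcases ((π'.prob_mem s).1 a).eq_or_lt with h0 | hpos
  · rw [← h0]
    simpa using (π.prob_mem s).1 a
  · refine le_trans ?_ (exp_neg_mul_le_of_klVec_le (π'.prob_mem s) (π.prob_mem s)
      ENNReal.toReal_nonneg (klVec_le_of_mem_klBall (hν s) hπ) hpos)
    exact mul_le_mul_of_nonneg_right
      ((min_le_left _ _).trans (h (s, a) (Real.exp_pos _))) hpos.le

end Divergence

section InducedChain

open Matrix

variable {S A : Type*} [Fintype S] [Fintype A] (M : Dynamics S A)

lemma inducedChain_mem_rowStochastic [DecidableEq S] (π : Policy S A) :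
    inducedChain M π ∈ rowStochastic ℝ S := by
  rw [mem_rowStochastic_iff_sum]
  refine ⟨fun i j => Finset.sum_nonneg fun a _ =>
    mul_nonneg ((π.prob_mem i).1 a) ((M.prob_mem i a).1 j), fun i => ?_⟩
  simp only [inducedChain, of_apply]
  rw [Finset.sum_comm]
  simp [← Finset.mul_sum, (M.prob_mem i _).2, (π.prob_mem i).2]

lemma mul_inducedChain_le {π' π : Policy S A} {δ : ℝ}
    (h : ∀ s a, δ * π'.prob s a ≤ π.prob s a) (i j : S) :
    δ * inducedChain M π' i j ≤ inducedChain M π i j := by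
  simp only [inducedChain, of_apply, Finset.mul_sum, ← mul_assoc]
  exact Finset.sum_le_sum fun a _ => mul_le_mul_of_nonneg_right (h i a) ((M.prob_mem i a).1 j)

lemma pow_mul_pow_apply_le [DecidableEq S] {P Q : Matrix S S ℝ} {δ : ℝ} (hδ : 0 ≤ δ)
    (hP : ∀ i j, 0 ≤ P i j) (h : ∀ i j, δ * P i j ≤ Q i j) (n : ℕ) (i j : S) :
    δ ^ n * (P ^ n) i j ≤ (Q ^ n) i j := by
  induction n generalizing j with
  | zero => simp
  | succ n ih =>
    rw [pow_succ P, pow_succ Q, mul_apply, mul_apply, Finset.mul_sum]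
    refine Finset.sum_le_sum fun k _ => ?_
    have hn := mul_nonneg (pow_nonneg hδ n) (pow_apply_nonneg hP n i k)
    calc δ ^ (n + 1) * ((P ^ n) i k * P k j) = (δ ^ n * (P ^ n) i k) * (δ * P k j) := by ring
      _ ≤ _ := mul_le_mul (ih k) (h k j) (mul_nonneg hδ (hP k j)) (hn.trans (ih k))

end InducedChain

end FiniteMDP

theorem lemma4 {S A : Type*} [Fintype S] [DecidableEq S] [Nonempty S] [Fintype A]
    [MeasurableSpace S] [MeasurableSingletonClass S]
    (M : FiniteMDP.Dynamics S A) (π' : FiniteMDP.Policy S A)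
    (hirr : (FiniteMDP.inducedChain M π').IsIrreducible)
    (haper : FiniteMDP.IsAperiodic (FiniteMDP.inducedChain M π')) :
    ∃ μ' : S → ℝ,
      (FiniteMDP.IsStationary (FiniteMDP.inducedChain M π') μ' ∧
        ∀ ρ, FiniteMDP.IsStationary (FiniteMDP.inducedChain M π') ρ → ρ = μ') ∧
      ∀ c : ℝ, 0 < c → ∀ ν : MeasureTheory.Measure S, (∀ s, 0 < ν {s}) →
        ∃ C m₁ m₂ : ℝ, 0 < C ∧ 0 < m₁ ∧ 0 < m₂ ∧
          ∀ π ∈ FiniteMDP.klBall ν π' c, ∃ μ : S → ℝ,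
            (FiniteMDP.IsStationary (FiniteMDP.inducedChain M π) μ ∧
              ∀ ρ, FiniteMDP.IsStationary (FiniteMDP.inducedChain M π) ρ → ρ = μ) ∧
            (∀ t : ℕ,
              ⨆ s, FiniteMDP.tvDist ((FiniteMDP.inducedChain M π ^ t) s) μ
                ≤ m₁ * Real.exp (-m₂ * t)) ∧
            (∀ s a, 0 < π'.prob s a →
              1 / C ≤ π'.prob s a / π.prob s a ∧ π'.prob s a / π.prob s a ≤ C) ∧
            (∀ s, 1 / C ≤ μ' s / μ s ∧ μ' s / μ s ≤ C) := by
  open FiniteMDP in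
  have hmem := inducedChain_mem_rowStochastic M
  obtain ⟨hnn, N, hN, hpos⟩ := haper.isPrimitive hirr
  obtain ⟨ε, hε, hle⟩ := exists_pos_forall_le_of_pos fun x : S × S =>
    (inducedChain M π' ^ N) x.1 x.2
  have hle' : ∀ i j, ε ≤ (inducedChain M π' ^ N) i j := fun i j => hle (i, j) (hpos i j)
  obtain ⟨μ', hμ'⟩ := exists_isStationary (hmem π')
  refine ⟨μ', ⟨hμ', fun ρ hρ => hμ'.eq_of_pow_pos (hmem π') hε hle' hρ⟩, fun c _ ν hν => ?_⟩
  obtain ⟨δ, hδ₀, hδ₁, hδ⟩ := exists_forall_mem_klBall_mul_le π' c hν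
  obtain ⟨β, hβ₀, hβ⟩ := exists_pos_forall_le_of_pos fun x : S × A => π'.prob x.1 x.2
  set η : ℝ := δ ^ N * ε
  have hη₀ : 0 < η := by positivity
  have hηε : η ≤ ε := mul_le_of_le_one_left hε.le (pow_le_one₀ hδ₀.le hδ₁)
  have hη : ∀ π ∈ klBall ν π' c, ∀ i j, η ≤ (inducedChain M π ^ N) i j := fun π hπ i j =>
    (mul_le_mul_of_nonneg_left (hle' i j) (by positivity)).trans
      (pow_mul_pow_apply_le hδ₀.le hnn (mul_inducedChain_le M (hδ π hπ)) N i j)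
  have hcard : (0 : ℝ) < Fintype.card S := by exact_mod_cast Fintype.card_pos
  -- The Doeblin factor may vanish; `2⁻¹` keeps `log r` meaningful.
  set r : ℝ := max (1 - Fintype.card S * η) 2⁻¹
  have hr₀ : 0 < r := lt_max_of_lt_right (by norm_num)
  have hr₁ : r < 1 := max_lt (by linarith [mul_pos hcard hη₀]) (by norm_num)
  have hN' : (0 : ℝ) < N := by exact_mod_cast hN
  -- For the policy ratios, `δ` gives the upper bound and `β` the lower; `η` gives both for the
  -- stationary ratios.
  set κ : ℝ := min (min δ β) η
  have hκ₀ : 0 < κ := lt_min (lt_min hδ₀ hβ₀) hη₀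
  have hκδ : κ ≤ δ := (min_le_left _ _).trans (min_le_left _ _)
  have hκβ : κ ≤ β := (min_le_left _ _).trans (min_le_right _ _)
  have hκη : κ ≤ η := min_le_right _ _
  have ratio : ∀ x y : ℝ, 0 < y → y ≤ 1 → κ ≤ x → κ * x ≤ y →
      1 / κ⁻¹ ≤ x / y ∧ x / y ≤ κ⁻¹ := fun x y hy hy₁ hx hxy => by
    refine ⟨?_, ?_⟩
    · rw [one_div, inv_inv, le_div_iff₀ hy]
      nlinarith
    · rwa [div_le_iff₀ hy, le_inv_mul_iff₀ hκ₀]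
  refine ⟨κ⁻¹, 2 * r⁻¹, -Real.log r / N, inv_pos.2 hκ₀, by positivity,
    div_pos (neg_pos.2 (Real.log_neg hr₀ hr₁)) hN', fun π hπ => ?_⟩
  obtain ⟨μ, hμ⟩ := exists_isStationary (hmem π)
  refine ⟨μ, ⟨hμ, fun ρ hρ => hμ.eq_of_pow_pos (hmem π) hη₀ (hη π hπ) hρ⟩, fun t => ?_,
    fun s a ha => ?_, fun s => ?_⟩
  · refine ciSup_le fun s => ?_
    rw [mul_assoc]
    exact (tvDist_pow_le (hmem π) (hη π hπ) hr₀.le (le_max_left _ _) hμ s t).trans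
      (mul_le_mul_of_nonneg_left (pow_div_le_exp hr₀ hr₁ hN t) zero_le_two)
  · have hdom := hδ π hπ s a
    refine ratio _ _ ((mul_pos hδ₀ ha).trans_le hdom) ?_ (hκβ.trans (hβ (s, a) ha))
      ((mul_le_mul_of_nonneg_right hκδ ha.le).trans hdom)
    rw [← (π.prob_mem s).2]
    exact Finset.single_le_sum (fun b _ => (π.prob_mem s).1 b) (Finset.mem_univ a)
  · have hμs := hμ.le_apply (hη π hπ) s
    refine ratio _ _ (hη₀.trans_le hμs) (hμ.apply_le_one s)
      ((hκη.trans hηε).trans (hμ'.le_apply hle' s)) ?_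
    exact (mul_le_of_le_one_right hκ₀.le (hμ'.apply_le_one s)).trans (hκη.trans hμs)
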